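/- **Setting.** Let $p,\nu,\xi$ be real constants with $\nu>0$, $0<p<\min\{\tfrac12,\nu^2\}$ and $p+\nu^2<\xi$. For every $h\in\mathbb N$ let the following be given. * *Dictionary.* Vectors $A^*_1,\dots,A^*_h\in\mathbb R^{n}$ ($n=n(h)$) with $\|A^*_i\|_2=1$ and $|\langle A^*_i,A^*_j\rangle|\le h^{-\xi}$ for $i\ne j$; let $A^*$ be the $n\times h$ matrix with these columns. * *Sparse code.* Real numbers $0\le a\le b$, $m_1\ge 0$, $m_2$ (all depending on $h$) and a random vector $x^*\in(\mathbb R^{\ge0})^h$ generated as follows. A random set $S\subseteq\{1,\dots,h\}$ is drawn from a distribution supported on sets of size at most $h^p$, such that $\Pr[i\in S]$ does not depend on $i$ and $\Pr[i,j\in S]$ does not depend on the pair $i\neq j$. Given $S$, $x^*$ is drawn from a distribution $D_S$ under which $x^*_i=0$ almost surely for $i\notin S$, the coordinates $(x^*_i)_{i\in S}$ are independent, and for every $i\in S$: $x^*_i\in[a,b]$ almost surely, $\mathbb E_{D_S}[x_i^*]=m_1$ and $\mathbb E_{D_S}[(x_i^*)^2]=m_2$. * *Autoencoder.* A number $\delta=\delta(h)$;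 for $W\in\mathbb R^{h\times n}$ with rows $W_1,\dots,W_h$, put $y=A^*x^*$, let $\epsilon\in\mathbb R^h$ be the bias all of whose entries are $2m_1h^p(\delta+h^{-\xi})$, and let $L=\tfrac12\|W^\top\mathrm{ReLU}(Wy-\epsilon)-y\|_2^2$. Assume that, as $h\to\infty$, $\delta=O(h^{-p-\nu^2})$, $a=\Omega(b\,h^{-\nu^2})$, and that $\exp\!\big(\tfrac{h^pm_1^2}{2(b-a)^2}\big)$ is superpolynomial in $h$, i.e. grows faster than $h^d$ for every $d$. **Theorem.** There is a function $g(h)=o\big(\max\{m_1^2,m_2\}/h^{1-p}\big)$ such that for all sufficiently large $h$, for every $W$ with $\|W_i-A^*_i\|_2\le\delta$ for all $i$, and for every $i=1,\dots,h$, the random vector $\partial L/\partial W_i$ is integrable and $$\Big\|\mathbb E\Big[\frac{\partial L}{\partial W_i}\Big]\Big\|_2\le g(h).$$ Here, on the event $\langle W_i,y\rangle=\epsilon_i$, where $L$ may fail to be differentiable in $W_i$, $\partial L/\partial W_i$ denotes the value given by the chain rule with $\mathrm{ReLU}'(0)=\tau$, where $\tau\in[0,1]$ is arbitrary; $g$ does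 not depend on $\tau$, $W$ or $i$. -/

import Mathlib

open MeasureTheory ProbabilityTheory Filter Asymptotics

noncomputable section

/-- Output `Wᵀ ReLU (W y - ε)` of the autoencoder; `W i` is the `i`-th row of the weight matrix. -/
def autoencoder {n h : ℕ} (W : Fin h → EuclideanSpace ℝ (Fin n)) (ε : Fin h → ℝ)
    (y : EuclideanSpace ℝ (Fin n)) : EuclideanSpace ℝ (Fin n) :=
  ∑ j, max 0 (inner ℝ (W j) y - ε j) • W j

/-- Squared reconstruction loss. -/
def aeLoss {n h : ℕ} (W : Fin h → EuclideanSpace ℝ (Fin n)) (ε : Fin h → ℝ)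
    (y : EuclideanSpace ℝ (Fin n)) : ℝ :=
  (1 / 2) * ‖autoencoder W ε y - y‖ ^ 2

/-- The partial gradient `∂L/∂W_i`. The loss is differentiable in `W_i` whenever
`⟨W_i, y⟩ ≠ ε_i` (see `hasGradientAt_aeLoss`). On the kink `⟨W_i, y⟩ = ε_i` it is the value given
by the chain rule when the derivative of `ReLU` at `0` is taken to be `τ`. -/
def aeGrad {n h : ℕ} (τ : ℝ) (W : Fin h → EuclideanSpace ℝ (Fin n)) (ε : Fin h → ℝ)
    (y : EuclideanSpace ℝ (Fin n)) (i : Fin h) : EuclideanSpace ℝ (Fin n) :=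
  if inner ℝ (W i) y = ε i then
    (τ * inner ℝ (W i) (autoencoder W ε y - y)) • y
  else
    gradient (fun w => aeLoss (Function.update W i w) ε y) (W i)

/-- Unit columns with pairwise coherence at most `h ^ (-ξ)`; `A i` is the `i`-th column. -/
structure IsIncoherentDictionary {n h : ℕ} (A : Fin h → EuclideanSpace ℝ (Fin n)) (ξ : ℝ) :
    Prop where
  norm_eq_one : ∀ i, ‖A i‖ = 1
  incoherent : ∀ i j, i ≠ j → |inner ℝ (A i) (A j)| ≤ (h : ℝ) ^ (-ξ)

/-- The signal `y = A x`. -/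
def signal {n h : ℕ} (A : Fin h → EuclideanSpace ℝ (Fin n)) (x : Fin h → ℝ) :
    EuclideanSpace ℝ (Fin n) :=
  ∑ j, x j • A j

/-- The assumptions on the law of the sparse code: a support `S` is drawn from `P`, then the code
is drawn from `D S`. The family of possible supports is the set of `S` with `P S ≠ 0`. -/
structure IsSparseCode {h : ℕ} (P : PMF (Finset (Fin h)))
    (D : Finset (Fin h) → Measure (Fin h → ℝ)) (p a b m₁ m₂ : ℝ) : Prop where
  card_le : ∀ S, P S ≠ 0 → (S.card : ℝ) ≤ (h : ℝ) ^ p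
  prob_single : ∃ q₁, ∀ i, P.toOuterMeasure {S | i ∈ S} = q₁
  prob_pair : ∃ q₂, ∀ i j, i ≠ j → P.toOuterMeasure {S | i ∈ S ∧ j ∈ S} = q₂
  isProbabilityMeasure : ∀ S, P S ≠ 0 → IsProbabilityMeasure (D S)
  support_subset : ∀ S, P S ≠ 0 → ∀ i, i ∉ S → ∀ᵐ x ∂(D S), x i = 0
  a_nonneg : 0 ≤ a
  mem_Icc : ∀ S, P S ≠ 0 → ∀ i ∈ S, ∀ᵐ x ∂(D S), x i ∈ Set.Icc a b
  indep : ∀ S, P S ≠ 0 → iIndepFun (fun (i : S) (x : Fin h → ℝ) => x i) (D S)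
  mean_eq : ∀ S, P S ≠ 0 → ∀ i ∈ S, ∫ x, x i ∂(D S) = m₁
  second_moment_eq : ∀ S, P S ≠ 0 → ∀ i ∈ S, ∫ x, x i ^ 2 ∂(D S) = m₂
  -- follows from the previous fields unless the support is almost surely empty
  mean_nonneg : 0 ≤ m₁

/-- The law of the sparse code: the mixture of the `D S` with weights `P S`. -/
def codeLaw {h : ℕ} (P : PMF (Finset (Fin h))) (D : Finset (Fin h) → Measure (Fin h → ℝ)) :
    Measure (Fin h → ℝ) :=
  ∑ S, P S • D S

/-- `f` grows faster than every polynomial. -/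
def Superpolynomial (f : ℕ → ℝ) : Prop :=
  ∀ d : ℕ, (fun h : ℕ => (h : ℝ) ^ d) =o[atTop] f

/-- The bias `2 m₁ k (δ + h ^ (-ξ))` with `k = h ^ p`, the same for every hidden unit. -/
def aeBias (h : ℕ) (p ξ m₁ δ : ℝ) : Fin h → ℝ :=
  fun _ => 2 * m₁ * (h : ℝ) ^ p * (δ + (h : ℝ) ^ (-ξ))

/-- Away from the kink the loss is differentiable in `W_i`, with the expected gradient. -/
theorem hasGradientAt_aeLoss {n h : ℕ} (W : Fin h → EuclideanSpace ℝ (Fin n)) (ε : Fin h → ℝ)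
    (y : EuclideanSpace ℝ (Fin n)) (i : Fin h) (hi : inner ℝ (W i) y ≠ ε i) :
    HasGradientAt (fun w => aeLoss (Function.update W i w) ε y)
      ((if ε i < inner ℝ (W i) y then (1 : ℝ) else 0) •
        ((inner ℝ (W i) y - ε i) • (autoencoder W ε y - y)
          + inner ℝ (W i) (autoencoder W ε y - y) • y)) (W i) := by
  have key : ∀ w, autoencoder (Function.update W i w) ε y
      = max 0 (inner ℝ w y - ε i) • w
        + ∑ j ∈ Finset.univ.erase i, max 0 (inner ℝ (W j) y - ε j) • W j := by
    intro w
    unfold autoencoder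
    rw [← Finset.add_sum_erase _ _ (Finset.mem_univ i)]
    congr 1
    · simp
    · refine Finset.sum_congr rfl fun j hj => ?_
      rw [Function.update_of_ne (Finset.ne_of_mem_erase hj)]
  set C := ∑ j ∈ Finset.univ.erase i, max 0 (inner ℝ (W j) y - ε j) • W j with hC
  have hW : autoencoder W ε y = max 0 (inner ℝ (W i) y - ε i) • W i + C := by
    rw [← key (W i), Function.update_eq_self]
  have hcont : Continuous fun w : EuclideanSpace ℝ (Fin n) => inner ℝ w y := by fun_prop
  rcases lt_or_gt_of_ne hi with hlt | hgt
  · rw [if_neg (not_lt.mpr hlt.le), zero_smul]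
    have hev : (fun w => aeLoss (Function.update W i w) ε y)
        =ᶠ[nhds (W i)] fun _ => (1 / 2) * ‖C - y‖ ^ 2 := by
      filter_upwards [hcont.continuousAt.eventually_lt continuousAt_const hlt] with w hw
      simp only [aeLoss, key w, max_eq_left (sub_nonpos.mpr (le_of_lt hw)), zero_smul, zero_add]
    exact (hasGradientAt_const _ _).congr_of_eventuallyEq hev
  · rw [if_pos hgt, one_smul]
    have hev : (fun w => aeLoss (Function.update W i w) ε y)
        =ᶠ[nhds (W i)] fun w => (1 / 2) * ‖(inner ℝ w y - ε i) • w + C - y‖ ^ 2 := by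
      filter_upwards [continuousAt_const.eventually_lt hcont.continuousAt hgt] with w hw
      simp only [aeLoss, key w, max_eq_right (sub_nonneg.mpr (le_of_lt hw))]
    refine HasGradientAt.congr_of_eventuallyEq ?_ hev
    rw [hW, max_eq_right (sub_nonneg.mpr hgt.le), hasGradientAt_iff_hasFDerivAt]
    have h1 : HasFDerivAt (fun w : EuclideanSpace ℝ (Fin n) => inner ℝ w y - ε i)
        (innerSL ℝ y) (W i) := by
      have := (innerSL ℝ y).hasFDerivAt (x := W i)
      simpa [real_inner_comm] using this.sub_const (ε i)
    have h2 := (((h1.smul (hasFDerivAt_id (W i))).add_const C).sub_const y).norm_sq.const_mul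
      (1 / 2 : ℝ)
    refine h2.congr_fderiv ?_
    ext v
    have e : ((fun w : EuclideanSpace ℝ (Fin n) => inner ℝ w y - ε i) • id) (W i)
        = (inner ℝ (W i) y - ε i) • W i := rfl
    rw [e]
    generalize (inner ℝ (W i) y - ε i) • W i + C - y = R
    simp [real_inner_comm]
    ring

end

/-!
Up to a kink convention, `∂L/∂W_i = ReLU'(⟨W_i, y⟩ - ε_i) • ((⟨W_i, y⟩ - ε_i) • R + ⟨W_i, R⟩ • y)`
with the residual `R = autoencoder W ε y - y`. The rows of `W` are nearly dual to the dictionary: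
`⟨W_i, y⟩` differs from `x_i` by at most `η ∑ x_j` with `η = δ + h ^ (-ξ)`. The bias is exactly the
value of this error for a code of mass `2 m₁ h ^ p`, twice the largest possible mean. Hence, for a
lighter code, the gradient vanishes unless `i` lies in the support, an event of probability at most
`h ^ (p - 1)`, and there it is `O(h ^ (2p) η) m₁ (x_i + m₁)`, whose mean is `o(m₁ ^ 2)` because
`h ^ (2p) η` tends to `0`. Heavier codes have superpolynomially small probability by Hoeffding's
inequality, and on them the gradient is at most a power of `h` times `m₁ ^ 2`.
-/

section LinearCombinations

variable {E ι : Type*} [Fintype ι]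

theorem norm_sum_smul_le [NormedAddCommGroup E] [NormedSpace ℝ E] {V : ι → E} {κ : ℝ}
    (hV : ∀ j, ‖V j‖ ≤ κ) (c : ι → ℝ) : ‖∑ j, c j • V j‖ ≤ κ * ∑ j, |c j| := by
  rw [Finset.mul_sum]
  refine norm_sum_le_of_le _ fun j _ => ?_
  rw [norm_smul, Real.norm_eq_abs, mul_comm]
  exact mul_le_mul_of_nonneg_right (hV j) (abs_nonneg _)

theorem abs_inner_sum_smul_sub_le [NormedAddCommGroup E] [InnerProductSpace ℝ E] [DecidableEq ι]
    {w : E} {V : ι → E} {i : ι} {κ : ℝ}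
    (hV : ∀ j, |inner ℝ w (V j) - if i = j then 1 else 0| ≤ κ) (c : ι → ℝ) :
    |inner ℝ w (∑ j, c j • V j) - c i| ≤ κ * ∑ j, |c j| := by
  have expand : inner ℝ w (∑ j, c j • V j) - c i
      = ∑ j, c j • (inner ℝ w (V j) - if i = j then 1 else 0) := by
    simp [inner_sum, inner_smul_right, mul_sub]
  rw [expand, ← Real.norm_eq_abs]
  exact norm_sum_smul_le hV c

end LinearCombinations

section ChainRule

variable {n h : ℕ}

/-- The derivative of `ReLU` at `t`, with the value `τ` at the kink `t = 0`. -/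
noncomputable def reluSlope (τ t : ℝ) : ℝ :=
  if t = 0 then τ else if 0 < t then 1 else 0

theorem reluSlope_of_neg (τ : ℝ) {t : ℝ} (ht : t < 0) : reluSlope τ t = 0 := by
  rw [reluSlope, if_neg ht.ne, if_neg ht.not_gt]

theorem abs_reluSlope_le_one {τ : ℝ} (hτ : |τ| ≤ 1) (t : ℝ) : |reluSlope τ t| ≤ 1 := by
  unfold reluSlope
  split_ifs <;> simp [hτ]

theorem measurable_reluSlope (τ : ℝ) : Measurable (reluSlope τ) :=
  Measurable.ite (measurableSet_singleton 0) measurable_const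
    (Measurable.ite measurableSet_Ioi measurable_const measurable_const)

/-- The activations `ReLU (⟨W_j, y⟩ - ε_j)` of the hidden units, which are the coefficients of the
rows of `W` in the output of the autoencoder. -/
noncomputable def activation (W : Fin h → EuclideanSpace ℝ (Fin n)) (ε : Fin h → ℝ)
    (y : EuclideanSpace ℝ (Fin n)) (j : Fin h) : ℝ :=
  max 0 (inner ℝ (W j) y - ε j)

theorem autoencoder_eq_sum_activation (W : Fin h → EuclideanSpace ℝ (Fin n)) (ε : Fin h → ℝ)
    (y : EuclideanSpace ℝ (Fin n)) :
    autoencoder W ε y = ∑ j, activation W ε y j • W j := rfl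

theorem aeGrad_eq_reluSlope_smul (τ : ℝ) (W : Fin h → EuclideanSpace ℝ (Fin n)) (ε : Fin h → ℝ)
    (y : EuclideanSpace ℝ (Fin n)) (i : Fin h) :
    aeGrad τ W ε y i = reluSlope τ (inner ℝ (W i) y - ε i) •
      ((inner ℝ (W i) y - ε i) • (autoencoder W ε y - y)
        + inner ℝ (W i) (autoencoder W ε y - y) • y) := by
  unfold aeGrad reluSlope
  simp only [sub_eq_zero, sub_pos]
  split_ifs with hkink hactive
  · rw [hkink, sub_self, zero_smul, zero_add, smul_smul]
  all_goals simpa [hactive] using (hasGradientAt_aeLoss W ε y i hkink).gradient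

theorem aeGrad_eq_zero_of_inner_lt (τ : ℝ) {W : Fin h → EuclideanSpace ℝ (Fin n)} {ε : Fin h → ℝ}
    {y : EuclideanSpace ℝ (Fin n)} {i : Fin h} (hi : inner ℝ (W i) y < ε i) :
    aeGrad τ W ε y i = 0 := by
  rw [aeGrad_eq_reluSlope_smul, reluSlope_of_neg τ (sub_neg.mpr hi), zero_smul]

theorem norm_aeGrad_le {τ : ℝ} (hτ : |τ| ≤ 1) (W : Fin h → EuclideanSpace ℝ (Fin n))
    (ε : Fin h → ℝ) (y : EuclideanSpace ℝ (Fin n)) (i : Fin h) :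
    ‖aeGrad τ W ε y i‖ ≤ |inner ℝ (W i) y - ε i| * ‖autoencoder W ε y - y‖
      + |inner ℝ (W i) (autoencoder W ε y - y)| * ‖y‖ := by
  rw [aeGrad_eq_reluSlope_smul, norm_smul]
  refine (mul_le_of_le_one_left (norm_nonneg _) (abs_reluSlope_le_one hτ _)).trans ?_
  refine (norm_add_le _ _).trans_eq ?_
  simp only [norm_smul, Real.norm_eq_abs]

theorem measurable_aeGrad (τ : ℝ) (W : Fin h → EuclideanSpace ℝ (Fin n)) (ε : Fin h → ℝ)
    (i : Fin h) : Measurable fun y => aeGrad τ W ε y i := by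
  have hout : Continuous (autoencoder W ε) := by
    unfold autoencoder
    fun_prop
  have hpre : Continuous fun y : EuclideanSpace ℝ (Fin n) => inner ℝ (W i) y - ε i := by fun_prop
  simp only [aeGrad_eq_reluSlope_smul]
  exact ((measurable_reluSlope τ).comp hpre.measurable).smul
    (Continuous.measurable (by fun_prop))

theorem measurable_signal (A : Fin h → EuclideanSpace ℝ (Fin n)) : Measurable (signal A) := by
  unfold signal
  fun_prop

theorem autoencoder_sub_signal (A W : Fin h → EuclideanSpace ℝ (Fin n)) (ε : Fin h → ℝ)
    (x : Fin h → ℝ) :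
    autoencoder W ε (signal A x) - signal A x
      = ∑ j, x j • (W j - A j) - ∑ j, (x j - activation W ε (signal A x) j) • W j := by
  simp only [smul_sub, sub_smul, Finset.sum_sub_distrib, ← autoencoder_eq_sum_activation]
  rw [sub_sub_sub_comm, ← sub_add, ← signal]
  abel

theorem norm_aeGrad_le_of_norm_le {τ : ℝ} (hτ : |τ| ≤ 1) {W : Fin h → EuclideanSpace ℝ (Fin n)}
    (hW : ∀ j, ‖W j‖ ≤ 2) {Y : ℝ} {ε : Fin h → ℝ} (hε : ∀ j, ε j ∈ Set.Icc 0 Y)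
    {y : EuclideanSpace ℝ (Fin n)} (hy : ‖y‖ ≤ Y) (i : Fin h) :
    ‖aeGrad τ W ε y i‖ ≤ 25 * h * Y ^ 2 := by
  have hY : 0 ≤ Y := (norm_nonneg y).trans hy
  have hh : (1 : ℝ) ≤ h := by exact_mod_cast i.pos
  have inner_W_le (j : Fin h) {v : EuclideanSpace ℝ (Fin n)} {B : ℝ} (hv : ‖v‖ ≤ B) :
      |inner ℝ (W j) v| ≤ 2 * B :=
    (abs_real_inner_le_norm _ _).trans (mul_le_mul (hW j) hv (norm_nonneg _) zero_le_two)
  have hact (j : Fin h) : |activation W ε y j| ≤ 2 * Y := by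
    rw [activation, abs_of_nonneg (le_max_left _ _)]
    exact max_le (by positivity) (by linarith [(abs_le.mp (inner_W_le j hy)).2, (hε j).1])
  have hout : ‖autoencoder W ε y‖ ≤ 4 * h * Y := by
    rw [autoencoder_eq_sum_activation]
    refine (norm_sum_smul_le hW _).trans ?_
    have := Finset.sum_le_card_nsmul Finset.univ _ _ fun j _ => hact j
    simp only [Finset.card_univ, Fintype.card_fin, nsmul_eq_mul] at this
    linarith
  have hres : ‖autoencoder W ε y - y‖ ≤ 5 * h * Y := by
    linarith [norm_sub_le (autoencoder W ε y) y, le_mul_of_one_le_left hY hh]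
  have hpre : |inner ℝ (W i) y - ε i| ≤ 3 * Y := by
    have := abs_le.mp (inner_W_le i hy)
    rw [abs_le]
    constructor <;> linarith [(hε i).1, (hε i).2]
  calc ‖aeGrad τ W ε y i‖
      ≤ |inner ℝ (W i) y - ε i| * ‖autoencoder W ε y - y‖
        + |inner ℝ (W i) (autoencoder W ε y - y)| * ‖y‖ := norm_aeGrad_le hτ W ε y i
    _ ≤ 3 * Y * (5 * h * Y) + 2 * (5 * h * Y) * Y := by
        gcongr
        exact inner_W_le i hres
    _ = 25 * h * Y ^ 2 := by ring

end ChainRule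

/-- The weight rows `W` are an `η`-perturbation of the unit vectors `A`, nearly dual to them: this
is all that the argument retains of the incoherence of the dictionary and of the distance from the
weights to it, with `η = δ + h ^ (-ξ)`. -/
structure IsPerturbedDictionary {n h : ℕ} (A W : Fin h → EuclideanSpace ℝ (Fin n)) (η : ℝ) :
    Prop where
  norm_eq_one : ∀ i, ‖A i‖ = 1
  norm_sub_le : ∀ i, ‖W i - A i‖ ≤ η
  abs_inner_sub_le : ∀ i j, |inner ℝ (W i) (A j) - if i = j then 1 else 0| ≤ η

theorem IsIncoherentDictionary.isPerturbedDictionary {n h : ℕ}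
    {A W : Fin h → EuclideanSpace ℝ (Fin n)} {ξ δ : ℝ} (hA : IsIncoherentDictionary A ξ)
    (hW : ∀ i, ‖W i - A i‖ ≤ δ) : IsPerturbedDictionary A W (δ + (h : ℝ) ^ (-ξ)) := by
  have hcoh : (0 : ℝ) ≤ (h : ℝ) ^ (-ξ) := by positivity
  refine ⟨hA.norm_eq_one, fun i => (hW i).trans (le_add_of_nonneg_right hcoh), fun i j => ?_⟩
  have hperturb : |inner ℝ (W i - A i) (A j)| ≤ δ := by
    simpa [hA.norm_eq_one] using
      (abs_real_inner_le_norm (W i - A i) (A j)).trans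
        (mul_le_mul_of_nonneg_right (hW i) (norm_nonneg _))
  have hgram : |inner ℝ (A i) (A j) - if i = j then 1 else 0| ≤ (h : ℝ) ^ (-ξ) := by
    split_ifs with hij
    · simpa [hij, hA.norm_eq_one] using hcoh
    · simpa using hA.incoherent i j hij
  calc |inner ℝ (W i) (A j) - if i = j then 1 else 0|
      = |inner ℝ (W i - A i) (A j) + (inner ℝ (A i) (A j) - if i = j then 1 else 0)| := by
        rw [inner_sub_left]
        ring_nf
    _ ≤ δ + (h : ℝ) ^ (-ξ) := (abs_add_le _ _).trans (add_le_add hperturb hgram)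

namespace IsPerturbedDictionary

variable {n h : ℕ} {A W : Fin h → EuclideanSpace ℝ (Fin n)} {η τ : ℝ} {x : Fin h → ℝ}

theorem norm_weight_le (hV : IsPerturbedDictionary A W η) (hη : η ≤ 1) (i : Fin h) :
    ‖W i‖ ≤ 2 := by
  linarith [norm_le_norm_add_norm_sub' (W i) (A i), hV.norm_sub_le i, hV.norm_eq_one i]

theorem norm_signal_le (hV : IsPerturbedDictionary A W η) (x : Fin h → ℝ) :
    ‖signal A x‖ ≤ ∑ j, |x j| := by
  simpa only [signal, one_mul] using norm_sum_smul_le (fun j => (hV.norm_eq_one j).le) x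

theorem abs_inner_weight_sub_le (hV : IsPerturbedDictionary A W η) (hη : η ≤ 1) (i j : Fin h) :
    |inner ℝ (W i) (W j) - if i = j then 1 else 0| ≤ 3 * η := by
  have hperturb : |inner ℝ (W i) (W j - A j)| ≤ 2 * η :=
    (abs_real_inner_le_norm _ _).trans
      (mul_le_mul (hV.norm_weight_le hη i) (hV.norm_sub_le j) (norm_nonneg _) zero_le_two)
  calc |inner ℝ (W i) (W j) - if i = j then 1 else 0|
      = |inner ℝ (W i) (W j - A j) + (inner ℝ (W i) (A j) - if i = j then 1 else 0)| := by
        rw [inner_sub_right]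
        ring_nf
    _ ≤ 2 * η + η := (abs_add_le _ _).trans (add_le_add hperturb (hV.abs_inner_sub_le i j))
    _ = 3 * η := by ring

theorem abs_inner_signal_sub_le (hV : IsPerturbedDictionary A W η) (x : Fin h → ℝ) (i : Fin h) :
    |inner ℝ (W i) (signal A x) - x i| ≤ η * ∑ j, |x j| :=
  abs_inner_sum_smul_sub_le (hV.abs_inner_sub_le i) x

theorem aeGrad_eq_zero_of_apply_eq_zero (hV : IsPerturbedDictionary A W η) (τ : ℝ)
    {ε : Fin h → ℝ} {i : Fin h} (hε : η * ∑ j, |x j| < ε i) (hi : x i = 0) :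
    aeGrad τ W ε (signal A x) i = 0 := by
  have hclose := hV.abs_inner_signal_sub_le x i
  rw [hi, sub_zero] at hclose
  exact aeGrad_eq_zero_of_inner_lt τ ((le_abs_self _).trans_lt (hclose.trans_lt hε))

theorem activation_mem_Icc (hV : IsPerturbedDictionary A W η) {ε : Fin h → ℝ} {i : Fin h}
    (hi : 0 ≤ x i) (hε : η * ∑ j, |x j| ≤ ε i) :
    activation W ε (signal A x) i ∈ Set.Icc (x i - 2 * ε i) (x i) := by
  have hclose := abs_le.mp ((hV.abs_inner_signal_sub_le x i).trans hε)
  refine ⟨le_max_of_le_right ?_, max_le hi ?_⟩ <;> linarith [hclose.1, hclose.2]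

theorem sum_abs_sub_activation_le (hV : IsPerturbedDictionary A W η) {ε : ℝ} (hx : ∀ j, 0 ≤ x j)
    (hε : η * ∑ j, |x j| ≤ ε) {S : Finset (Fin h)} (hS : ∀ j ∉ S, x j = 0) :
    ∑ j, |x j - activation W (fun _ => ε) (signal A x) j| ≤ 2 * ε * S.card := by
  have hact (j : Fin h) := hV.activation_mem_Icc (ε := fun _ => ε) (hx j) hε
  have hzero : ∀ j ∉ S, |x j - activation W (fun _ => ε) (signal A x) j| = 0 := fun j hj => by
    have hpos : 0 ≤ activation W (fun _ => ε) (signal A x) j := le_max_left _ _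
    rw [abs_eq_zero, hS j hj]
    linarith [(hact j).2, hS j hj]
  rw [← Finset.sum_subset (Finset.subset_univ S) fun j _ => hzero j, mul_comm, ← nsmul_eq_mul]
  refine Finset.sum_le_card_nsmul _ _ _ fun j _ => ?_
  rw [abs_of_nonneg (sub_nonneg.mpr (hact j).2)]
  linarith [(hact j).1]

theorem norm_autoencoder_sub_signal_le (hV : IsPerturbedDictionary A W η) (hη : η ≤ 1) {ε : ℝ}
    (hx : ∀ j, 0 ≤ x j) (hε : η * ∑ j, |x j| ≤ ε) {S : Finset (Fin h)}
    (hS : ∀ j ∉ S, x j = 0) :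
    ‖autoencoder W (fun _ => ε) (signal A x) - signal A x‖ ≤ ε + 4 * ε * S.card := by
  rw [autoencoder_sub_signal]
  have hdict : ‖∑ j, x j • (W j - A j)‖ ≤ ε :=
    (norm_sum_smul_le (V := fun j => W j - A j) hV.norm_sub_le x).trans hε
  have hact : ‖∑ j, (x j - activation W (fun _ => ε) (signal A x) j) • W j‖
      ≤ 2 * (2 * ε * S.card) :=
    (norm_sum_smul_le (hV.norm_weight_le hη) _).trans
      (mul_le_mul_of_nonneg_left (hV.sum_abs_sub_activation_le hx hε hS) zero_le_two)
  exact (norm_sub_le_of_le hdict hact).trans_eq (by ring)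

theorem abs_inner_residual_le (hV : IsPerturbedDictionary A W η) (hη : η ≤ 1) {ε : ℝ}
    (hx : ∀ j, 0 ≤ x j) (hε : η * ∑ j, |x j| ≤ ε) (i : Fin h) :
    |inner ℝ (W i) (autoencoder W (fun _ => ε) (signal A x) - signal A x)| ≤ 6 * ε := by
  have hη0 : 0 ≤ η := (norm_nonneg _).trans (hV.norm_sub_le i)
  set r := activation W (fun _ => ε) (signal A x) with hr
  have hact (j : Fin h) : r j ∈ Set.Icc (x j - 2 * ε) (x j) :=
    hV.activation_mem_Icc (ε := fun _ => ε) (hx j) hε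
  have hmass : ∑ j, |r j| ≤ ∑ j, |x j| := Finset.sum_le_sum fun j _ => by
    rw [abs_of_nonneg (hx j), hr, activation, abs_of_nonneg (le_max_left _ _)]
    exact (hact j).2
  have hout := abs_inner_sum_smul_sub_le (hV.abs_inner_weight_sub_le hη i) r
  rw [hr, ← autoencoder_eq_sum_activation, ← hr] at hout
  have hout' := abs_le.mp (hout.trans (mul_le_mul_of_nonneg_left hmass (by positivity)))
  have hsig := abs_le.mp ((hV.abs_inner_signal_sub_le x i).trans hε)
  rw [inner_sub_right, abs_le]
  constructor <;> linarith [(hact i).1, (hact i).2, hout'.1, hout'.2, hsig.1, hsig.2]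

theorem norm_aeGrad_le_of_support_subset (hV : IsPerturbedDictionary A W η) (hη : η ≤ 1)
    (hτ : |τ| ≤ 1) {ε : ℝ} (hx : ∀ j, 0 ≤ x j) (hε : η * ∑ j, |x j| ≤ ε)
    {S : Finset (Fin h)} (hS : ∀ j ∉ S, x j = 0) (i : Fin h) :
    ‖aeGrad τ W (fun _ => ε) (signal A x) i‖
      ≤ (x i + 2 * ε) * (ε + 4 * ε * S.card) + 6 * ε * ∑ j, |x j| := by
  have hη0 : 0 ≤ η := (norm_nonneg _).trans (hV.norm_sub_le i)
  have hε0 : 0 ≤ ε := le_trans (by positivity) hε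
  have hpre : |inner ℝ (W i) (signal A x) - ε| ≤ x i + 2 * ε := by
    have hclose := abs_le.mp ((hV.abs_inner_signal_sub_le x i).trans hε)
    rw [abs_le]
    constructor <;> linarith [hx i, hclose.1, hclose.2]
  refine (norm_aeGrad_le hτ _ _ _ _).trans (add_le_add ?_ ?_)
  · exact mul_le_mul hpre (hV.norm_autoencoder_sub_signal_le hη hx hε hS) (norm_nonneg _)
      (by linarith [hx i])
  · exact mul_le_mul (hV.abs_inner_residual_le hη hx hε i) (hV.norm_signal_le x) (norm_nonneg _)
      (by positivity)

theorem norm_aeGrad_le_of_sum_le (hV : IsPerturbedDictionary A W η) (hτ : |τ| ≤ 1) {m k : ℝ}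
    (hm : 0 ≤ m) (hk : 1 ≤ k) (hkη : 2 * k ^ 2 * η ≤ 1) (hx : ∀ j, 0 ≤ x j)
    (hmass : ∑ j, |x j| ≤ 2 * m * k) {S : Finset (Fin h)} (hS : ∀ j ∉ S, x j = 0)
    (hcard : S.card ≤ k) (i : Fin h) :
    ‖aeGrad τ W (fun _ => 2 * m * k * η) (signal A x) i‖
      ≤ k ^ 2 * η * m * (10 * x i + 44 * m) := by
  have hη0 : 0 ≤ η := (norm_nonneg _).trans (hV.norm_sub_le i)
  have hkη' : 2 * k * η ≤ 1 := by nlinarith [mul_nonneg (zero_le_one.trans hk) hη0]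
  have hη : η ≤ 1 := by nlinarith
  have hε : η * ∑ j, |x j| ≤ 2 * m * k * η := by
    rw [mul_comm]
    exact mul_le_mul_of_nonneg_right hmass hη0
  have hεm : 2 * m * k * η ≤ m := by nlinarith
  have hε0 : 0 ≤ 2 * m * k * η := by positivity
  have hres : 2 * m * k * η + 4 * (2 * m * k * η) * S.card ≤ 10 * m * k ^ 2 * η := by
    nlinarith [mul_le_mul_of_nonneg_left hcard hε0, le_mul_of_one_le_right hε0 hk]
  have hxi := hx i
  calc ‖aeGrad τ W (fun _ => 2 * m * k * η) (signal A x) i‖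
      ≤ (x i + 2 * (2 * m * k * η)) * (2 * m * k * η + 4 * (2 * m * k * η) * S.card)
        + 6 * (2 * m * k * η) * ∑ j, |x j| :=
          hV.norm_aeGrad_le_of_support_subset hη hτ hx hε hS i
    _ ≤ (x i + 2 * m) * (10 * m * k ^ 2 * η) + 6 * (2 * m * k * η) * (2 * m * k) := by
        gcongr (_ + _ * ?_) * ?_ + _ * ?_
    _ = k ^ 2 * η * m * (10 * x i + 44 * m) := by ring

end IsPerturbedDictionary

theorem measureReal_le_sum_le_exp_of_mem_Icc {Ω ι : Type*} [MeasurableSpace Ω] {μ : Measure Ω}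
    [IsProbabilityMeasure μ] {X : ι → Ω → ℝ} {s : Finset ι} {a b m t : ℝ} (hind : iIndepFun X μ)
    (hX : ∀ i ∈ s, AEMeasurable (X i) μ) (hmem : ∀ i ∈ s, ∀ᵐ ω ∂μ, X i ω ∈ Set.Icc a b)
    (hmean : ∀ i ∈ s, ∫ ω, X i ω ∂μ = m) (ht : 0 ≤ t) :
    μ.real {ω | s.card * m + t ≤ ∑ i ∈ s, X i ω}
      ≤ Real.exp (-(2 * t ^ 2 / (s.card * (b - a) ^ 2))) := by
  have hsub : ∀ i ∈ s, HasSubgaussianMGF (fun ω => X i ω - m) ((‖b - a‖₊ / 2) ^ 2) μ :=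
    fun i hi => by simpa only [hmean i hi] using hasSubgaussianMGF_of_mem_Icc (hX i hi) (hmem i hi)
  have hcenter : iIndepFun (fun i ω => X i ω - m) μ :=
    hind.comp (fun _ r => r - m) fun _ => measurable_id.sub_const m
  convert HasSubgaussianMGF.measure_sum_ge_le_of_iIndepFun hcenter hsub ht using 3
  · ext ω
    simp only [Finset.sum_sub_distrib, Finset.sum_const, nsmul_eq_mul,
      le_sub_iff_add_le']
  · rw [neg_div]
    simp only [Finset.sum_const, nsmul_eq_mul, NNReal.coe_mul, NNReal.coe_natCast, NNReal.coe_pow,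
      NNReal.coe_div, coe_nnnorm, Real.norm_eq_abs, NNReal.coe_ofNat, div_pow, sq_abs]
    congr 1
    field_simp

section Mixture

theorem sum_toReal_pmf_eq_one {α : Type*} [Fintype α] (P : PMF α) :
    ∑ s, (P s).toReal = 1 := by
  have hsum : ∑ s, P s = 1 := by rw [← P.tsum_coe, tsum_fintype]
  rw [← ENNReal.toReal_sum fun s _ => P.apply_ne_top s, hsum, ENNReal.toReal_one]

variable {h : ℕ} {P : PMF (Finset (Fin h))} {D : Finset (Fin h) → Measure (Fin h → ℝ)}
  {E : Type*} [NormedAddCommGroup E] {f : (Fin h → ℝ) → E}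

theorem integrable_codeLaw (hf : ∀ S, P S ≠ 0 → Integrable f (D S)) :
    Integrable f (codeLaw P D) := by
  refine integrable_finsetSum_measure.mpr fun S _ => ?_
  by_cases hS : P S = 0
  · simp [hS]
  · exact (hf S hS).smul_measure (P.apply_ne_top S)

theorem norm_integral_codeLaw_le [NormedSpace ℝ E] (hf : ∀ S, P S ≠ 0 → Integrable f (D S))
    {B : Finset (Fin h) → ℝ} (hB : ∀ S, P S ≠ 0 → ‖∫ x, f x ∂(D S)‖ ≤ B S) :
    ‖∫ x, f x ∂(codeLaw P D)‖ ≤ ∑ S, (P S).toReal * B S := by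
  rw [codeLaw, integral_finsetSum_measure (integrable_finsetSum_measure.mp (integrable_codeLaw hf))]
  refine norm_sum_le_of_le _ fun S _ => ?_
  rw [integral_smul_measure, norm_smul, Real.norm_of_nonneg ENNReal.toReal_nonneg]
  by_cases hS : P S = 0
  · simp [hS]
  · exact mul_le_mul_of_nonneg_left (hB S hS) ENNReal.toReal_nonneg

end Mixture

namespace IsSparseCode

variable {h : ℕ} {P : PMF (Finset (Fin h))} {D : Finset (Fin h) → Measure (Fin h → ℝ)}
  {p a b m₁ m₂ : ℝ} {S : Finset (Fin h)}

theorem ae_eq_zero (hc : IsSparseCode P D p a b m₁ m₂) (hS : P S ≠ 0) :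
    ∀ᵐ x ∂(D S), ∀ j ∉ S, x j = 0 :=
  ae_all_iff.mpr fun j => eventually_imp_distrib_left.mpr (hc.support_subset S hS j)

theorem ae_mem_Icc (hc : IsSparseCode P D p a b m₁ m₂) (hS : P S ≠ 0) :
    ∀ᵐ x ∂(D S), ∀ j ∈ S, x j ∈ Set.Icc a b :=
  ae_all_iff.mpr fun j => eventually_imp_distrib_left.mpr (hc.mem_Icc S hS j)

theorem ae_nonneg (hc : IsSparseCode P D p a b m₁ m₂) (hS : P S ≠ 0) :
    ∀ᵐ x ∂(D S), ∀ j, 0 ≤ x j := by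
  filter_upwards [hc.ae_eq_zero hS, hc.ae_mem_Icc hS] with x hzero hmem j
  by_cases hj : j ∈ S
  · exact hc.a_nonneg.trans (hmem j hj).1
  · exact (hzero j hj).ge

theorem integrable_apply (hc : IsSparseCode P D p a b m₁ m₂) (hS : P S ≠ 0) (i : Fin h) :
    Integrable (fun x => x i) (D S) := by
  have := hc.isProbabilityMeasure S hS
  by_cases hi : i ∈ S
  · exact Integrable.of_mem_Icc a b (measurable_pi_apply i).aemeasurable (hc.mem_Icc S hS i hi)
  · exact (integrable_zero _ _ _).congr ((hc.support_subset S hS i hi).mono fun _ hx => hx.symm)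

theorem integral_apply (hc : IsSparseCode P D p a b m₁ m₂) (hS : P S ≠ 0) (i : Fin h) :
    ∫ x, x i ∂(D S) = if i ∈ S then m₁ else 0 := by
  split_ifs with hi
  · exact hc.mean_eq S hS i hi
  · exact integral_eq_zero_of_ae (hc.support_subset S hS i hi)

theorem mean_mem_Icc (hc : IsSparseCode P D p a b m₁ m₂) (hS : P S ≠ 0) (hne : S.Nonempty) :
    m₁ ∈ Set.Icc a b := by
  obtain ⟨i, hi⟩ := hne
  have := hc.isProbabilityMeasure S hS
  rw [← hc.mean_eq S hS i hi]
  exact (convex_Icc a b).integral_mem isClosed_Icc (hc.mem_Icc S hS i hi)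
    (hc.integrable_apply hS i)

theorem one_le_rpow (hc : IsSparseCode P D p a b m₁ m₂) (hS : P S ≠ 0) (hne : S.Nonempty) :
    1 ≤ (h : ℝ) ^ p :=
  le_trans (by exact_mod_cast hne.card_pos) (hc.card_le S hS)

theorem measureReal_sum_support_le_exp (hc : IsSparseCode P D p a b m₁ m₂) (hS : P S ≠ 0)
    (hne : S.Nonempty) :
    (D S).real {x | 2 * m₁ * (h : ℝ) ^ p ≤ ∑ j ∈ S, x j}
      ≤ Real.exp (-((h : ℝ) ^ p * m₁ ^ 2 / (2 * (b - a) ^ 2))) := by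
  have := hc.isProbabilityMeasure S hS
  set k := (h : ℝ) ^ p
  have hcard : (S.card : ℝ) ≤ k := hc.card_le S hS
  have hcard0 : (0 : ℝ) < S.card := by exact_mod_cast hne.card_pos
  have hoeffding := measureReal_le_sum_le_exp_of_mem_Icc (s := Finset.univ) (t := m₁ * k)
    (hc.indep S hS) (fun i _ => (measurable_pi_apply (i : Fin h)).aemeasurable)
    (fun i _ => hc.mem_Icc S hS i i.2) (fun i _ => hc.mean_eq S hS i i.2)
    (mul_nonneg hc.mean_nonneg (hcard0.le.trans hcard))
  simp only [Finset.card_univ, Fintype.card_coe] at hoeffding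
  refine (measureReal_mono fun x hx => ?_).trans (hoeffding.trans ?_)
  · simp only [Set.mem_ofPred_eq] at hx ⊢
    rw [Finset.sum_coe_sort S fun j => x j]
    nlinarith [mul_le_mul_of_nonneg_right hcard hc.mean_nonneg]
  · rw [Real.exp_le_exp, neg_le_neg_iff, div_mul_eq_div_div, div_mul_eq_div_div]
    refine div_le_div_of_nonneg_right ?_ (sq_nonneg _)
    rw [div_le_div_iff₀ two_pos hcard0]
    nlinarith [mul_le_mul_of_nonneg_left hcard
      (mul_nonneg (hcard0.le.trans hcard) (sq_nonneg m₁)), sq_nonneg (m₁ * k)]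

theorem measureReal_sum_le_exp (hc : IsSparseCode P D p a b m₁ m₂) (hS : P S ≠ 0) (hh : 0 < h)
    (hm : 0 < m₁) :
    (D S).real {x | 2 * m₁ * (h : ℝ) ^ p ≤ ∑ j, x j}
      ≤ Real.exp (-((h : ℝ) ^ p * m₁ ^ 2 / (2 * (b - a) ^ 2))) := by
  have hsupport : {x : Fin h → ℝ | 2 * m₁ * (h : ℝ) ^ p ≤ ∑ j, x j}
      =ᵐ[D S] {x | 2 * m₁ * (h : ℝ) ^ p ≤ ∑ j ∈ S, x j} := by
    refine eventuallyEq_set.mpr ((hc.ae_eq_zero hS).mono fun x hzero => ?_)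
    simp only [Set.mem_ofPred_eq, Finset.sum_subset (Finset.subset_univ S) fun j _ hj => hzero j hj]
  rw [measureReal_congr hsupport]
  rcases S.eq_empty_or_nonempty with rfl | hne
  · have : ¬ 2 * m₁ * (h : ℝ) ^ p ≤ 0 := not_le.mpr (by positivity)
    simp [this, Real.exp_nonneg]
  · exact hc.measureReal_sum_support_le_exp hS hne

theorem sum_toReal_mem_le_rpow (hc : IsSparseCode P D p a b m₁ m₂) (i : Fin h) :
    ∑ S with i ∈ S, (P S).toReal ≤ (h : ℝ) ^ (p - 1) := by
  have hh : (0 : ℝ) < h := by exact_mod_cast i.pos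
  obtain ⟨q, hq⟩ := hc.prob_single
  have hmarginal (j : Fin h) : ∑ S with j ∈ S, (P S).toReal = q.toReal := by
    rw [← hq j, PMF.toOuterMeasure_apply_fintype, ← ENNReal.toReal_sum fun S _ => P.apply_ne_top S,
      Finset.sum_filter]
    simp only [Set.indicator_apply, Set.mem_ofPred_eq]
  -- Double counting: the `h` equal marginals add up to the mean size of the support.
  have hsum : h * q.toReal ≤ (h : ℝ) ^ p := by
    calc h * q.toReal = ∑ j : Fin h, ∑ S with j ∈ S, (P S).toReal := by simp [hmarginal]
      _ = ∑ S, (P S).toReal * (S.card : ℝ) := by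
          simp only [Finset.sum_filter]
          rw [Finset.sum_comm]
          simp [mul_comm]
      _ ≤ ∑ S, (P S).toReal * (h : ℝ) ^ p := by
          refine Finset.sum_le_sum fun S _ => ?_
          by_cases hS : P S = 0
          · simp [hS]
          · exact mul_le_mul_of_nonneg_left (hc.card_le S hS) ENNReal.toReal_nonneg
      _ = (h : ℝ) ^ p := by rw [← Finset.sum_mul, sum_toReal_pmf_eq_one, one_mul]
  rw [hmarginal, Real.rpow_sub_one hh.ne', le_div_iff₀' hh]
  exact hsum

end IsSparseCode

section ExpectedGradient

variable {n h : ℕ} {A W : Fin h → EuclideanSpace ℝ (Fin n)}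
  {P : PMF (Finset (Fin h))} {D : Finset (Fin h) → Measure (Fin h → ℝ)}
  {p a b m₁ m₂ η K τ : ℝ} {S : Finset (Fin h)}

theorem ae_norm_aeGrad_le (hV : IsPerturbedDictionary A W η)
    (hc : IsSparseCode P D p a b m₁ m₂) (hS : P S ≠ 0) (hne : S.Nonempty)
    (hkη : 2 * ((h : ℝ) ^ p) ^ 2 * η ≤ 1) (hb : b ≤ K * a) (hK : 0 ≤ K) (hτ : |τ| ≤ 1)
    (i : Fin h) :
    ∀ᵐ x ∂(D S), ‖aeGrad τ W (fun _ => 2 * m₁ * (h : ℝ) ^ p * η) (signal A x) i‖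
      ≤ 25 * h ^ 3 * (K * m₁) ^ 2 := by
  set k := (h : ℝ) ^ p
  have hη0 : 0 ≤ η := (norm_nonneg _).trans (hV.norm_sub_le i)
  have hk : 1 ≤ k := hc.one_le_rpow hS hne
  have hm := hc.mean_nonneg
  obtain ⟨ham, hmb⟩ := hc.mean_mem_Icc hS hne
  have hb0 : 0 ≤ b := hm.trans hmb
  have hh : (1 : ℝ) ≤ h := by exact_mod_cast i.pos
  have hkη' : 2 * k * η ≤ 1 := by nlinarith [mul_nonneg (zero_le_one.trans hk) hη0]
  have hbias : 2 * m₁ * k * η ∈ Set.Icc 0 (h * b) := by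
    refine ⟨by positivity, ?_⟩
    nlinarith [le_mul_of_one_le_left hb0 hh]
  filter_upwards [hc.ae_nonneg hS, hc.ae_eq_zero hS, hc.ae_mem_Icc hS] with x hx hzero hmem
  have hxb (j : Fin h) : |x j| ≤ b := by
    rw [abs_of_nonneg (hx j)]
    by_cases hj : j ∈ S
    · exact (hmem j hj).2
    · exact (hzero j hj).trans_le hb0
  have hsignal : ‖signal A x‖ ≤ h * b := by
    refine (hV.norm_signal_le x).trans ?_
    simpa using Finset.sum_le_card_nsmul Finset.univ _ _ fun j _ => hxb j
  calc ‖aeGrad τ W (fun _ => 2 * m₁ * k * η) (signal A x) i‖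
      ≤ 25 * h * (h * b) ^ 2 :=
        norm_aeGrad_le_of_norm_le hτ (hV.norm_weight_le (by nlinarith)) (fun _ => hbias) hsignal i
    _ = 25 * h ^ 3 * b ^ 2 := by ring
    _ ≤ 25 * h ^ 3 * (K * m₁) ^ 2 := by
        gcongr
        exact hb.trans (mul_le_mul_of_nonneg_left ham hK)

theorem ae_norm_aeGrad_le_of_sum_lt (hV : IsPerturbedDictionary A W η) (hη : 0 < η)
    (hc : IsSparseCode P D p a b m₁ m₂) (hS : P S ≠ 0)
    (hkη : 2 * ((h : ℝ) ^ p) ^ 2 * η ≤ 1) (hτ : |τ| ≤ 1) (i : Fin h) :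
    ∀ᵐ x ∂(D S), ∑ j, x j < 2 * m₁ * (h : ℝ) ^ p →
      ‖aeGrad τ W (fun _ => 2 * m₁ * (h : ℝ) ^ p * η) (signal A x) i‖
        ≤ ((h : ℝ) ^ p) ^ 2 * η * m₁ * (10 * x i + if i ∈ S then 44 * m₁ else 0) := by
  filter_upwards [hc.ae_nonneg hS, hc.ae_eq_zero hS] with x hx hzero hmass
  have habs : ∑ j, |x j| = ∑ j, x j := Finset.sum_congr rfl fun j _ => abs_of_nonneg (hx j)
  split_ifs with hi
  · exact hV.norm_aeGrad_le_of_sum_le hτ hc.mean_nonneg (hc.one_le_rpow hS ⟨i, hi⟩) hkη hx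
      (habs.trans_le hmass.le) hzero (hc.card_le S hS) i
  · have hbias : η * ∑ j, |x j| < 2 * m₁ * (h : ℝ) ^ p * η := by
      rw [habs, mul_comm]
      exact mul_lt_mul_of_pos_right hmass hη
    rw [hV.aeGrad_eq_zero_of_apply_eq_zero τ hbias (hzero i hi), hzero i hi]
    simp

theorem ae_norm_aeGrad_le_add_indicator (hV : IsPerturbedDictionary A W η) (hη : 0 < η)
    (hc : IsSparseCode P D p a b m₁ m₂) (hS : P S ≠ 0) (hm : 0 < m₁)
    (hkη : 2 * ((h : ℝ) ^ p) ^ 2 * η ≤ 1) (hb : b ≤ K * a) (hK : 0 ≤ K) (hτ : |τ| ≤ 1)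
    (i : Fin h) :
    ∀ᵐ x ∂(D S), ‖aeGrad τ W (fun _ => 2 * m₁ * (h : ℝ) ^ p * η) (signal A x) i‖
      ≤ ((h : ℝ) ^ p) ^ 2 * η * m₁ * (10 * x i + if i ∈ S then 44 * m₁ else 0)
        + {x : Fin h → ℝ | 2 * m₁ * (h : ℝ) ^ p ≤ ∑ j, x j}.indicator
            (fun _ => 25 * h ^ 3 * (K * m₁) ^ 2) x := by
  have hheavy : ∀ᵐ x ∂(D S), 2 * m₁ * (h : ℝ) ^ p ≤ ∑ j, x j →
      ‖aeGrad τ W (fun _ => 2 * m₁ * (h : ℝ) ^ p * η) (signal A x) i‖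
        ≤ 25 * h ^ 3 * (K * m₁) ^ 2 := by
    rcases S.eq_empty_or_nonempty with rfl | hne
    · filter_upwards [hc.ae_eq_zero hS] with x hzero hmass
      have hh : (0 : ℝ) < h := by exact_mod_cast i.pos
      have hsum : ∑ j, x j = 0 := Finset.sum_eq_zero fun j _ => hzero j (Finset.notMem_empty j)
      exact absurd (hmass.trans_eq hsum) (not_le.mpr (by positivity))
    · exact (ae_norm_aeGrad_le hV hc hS hne hkη hb hK hτ i).mono fun x hx _ => hx
  filter_upwards [hc.ae_nonneg hS, hheavy, ae_norm_aeGrad_le_of_sum_lt hV hη hc hS hkη hτ i]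
    with x hx hheavy hlight
  by_cases hmass : 2 * m₁ * (h : ℝ) ^ p ≤ ∑ j, x j
  · rw [Set.indicator_of_mem (Set.mem_ofPred_eq ▸ hmass)]
    refine (hheavy hmass).trans (le_add_of_nonneg_left ?_)
    have := hx i
    split_ifs <;> positivity
  · rw [Set.indicator_of_notMem (Set.mem_ofPred_eq ▸ hmass), add_zero]
    exact hlight (not_le.mp hmass)

theorem integrable_and_norm_integral_aeGrad_le (hV : IsPerturbedDictionary A W η) (hη : 0 < η)
    (hc : IsSparseCode P D p a b m₁ m₂) (hS : P S ≠ 0) (hm : 0 < m₁)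
    (hkη : 2 * ((h : ℝ) ^ p) ^ 2 * η ≤ 1) (hb : b ≤ K * a) (hK : 0 ≤ K) (hτ : |τ| ≤ 1)
    (i : Fin h) :
    Integrable (fun x => aeGrad τ W (fun _ => 2 * m₁ * (h : ℝ) ^ p * η) (signal A x) i) (D S) ∧
    ‖∫ x, aeGrad τ W (fun _ => 2 * m₁ * (h : ℝ) ^ p * η) (signal A x) i ∂(D S)‖
      ≤ (if i ∈ S then 54 * (((h : ℝ) ^ p) ^ 2 * η) * m₁ ^ 2 else 0)
        + 25 * h ^ 3 * (K * m₁) ^ 2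
          * Real.exp (-((h : ℝ) ^ p * m₁ ^ 2 / (2 * (b - a) ^ 2))) := by
  have := hc.isProbabilityMeasure S hS
  have hbound := ae_norm_aeGrad_le_add_indicator hV hη hc hS hm hkη hb hK hτ i
  set heavy := {x : Fin h → ℝ | 2 * m₁ * (h : ℝ) ^ p ≤ ∑ j, x j}
  have hheavy : MeasurableSet heavy := measurableSet_le measurable_const (by fun_prop)
  have hlin : Integrable (fun x : Fin h → ℝ => 10 * x i + if i ∈ S then 44 * m₁ else 0) (D S) :=
    ((hc.integrable_apply hS i).const_mul 10).add (integrable_const _)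
  have hind : Integrable (heavy.indicator fun _ => 25 * h ^ 3 * (K * m₁) ^ 2) (D S) :=
    (integrable_const _).indicator hheavy
  have hmaj := (hlin.const_mul (((h : ℝ) ^ p) ^ 2 * η * m₁)).add hind
  have hmeas := (measurable_aeGrad τ W (fun _ => 2 * m₁ * (h : ℝ) ^ p * η) i).comp
    (measurable_signal A)
  refine ⟨hmaj.mono' hmeas.aestronglyMeasurable hbound, ?_⟩
  refine (norm_integral_le_of_norm_le hmaj hbound).trans ?_
  rw [integral_add' (hlin.const_mul _) hind, integral_const_mul,
    integral_add ((hc.integrable_apply hS i).const_mul 10) (integrable_const _),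
    integral_const_mul, hc.integral_apply hS, integral_const, probReal_univ, one_smul,
    integral_indicator_const _ hheavy, smul_eq_mul, mul_comm ((D S).real heavy)]
  refine add_le_add (le_of_eq ?_) ?_
  · split_ifs <;> ring
  · gcongr
    exact hc.measureReal_sum_le_exp hS i.pos hm

theorem integrable_and_norm_integral_aeGrad_codeLaw_le (hV : IsPerturbedDictionary A W η)
    (hη : 0 < η) (hc : IsSparseCode P D p a b m₁ m₂) (hm : 0 < m₁)
    (hkη : 2 * ((h : ℝ) ^ p) ^ 2 * η ≤ 1) (hb : b ≤ K * a) (hK : 0 ≤ K) (hτ : |τ| ≤ 1)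
    (i : Fin h) :
    Integrable (fun x => aeGrad τ W (fun _ => 2 * m₁ * (h : ℝ) ^ p * η) (signal A x) i)
      (codeLaw P D) ∧
    ‖∫ x, aeGrad τ W (fun _ => 2 * m₁ * (h : ℝ) ^ p * η) (signal A x) i ∂(codeLaw P D)‖
      ≤ (h : ℝ) ^ (p - 1) * (54 * (((h : ℝ) ^ p) ^ 2 * η) * m₁ ^ 2)
        + 25 * h ^ 3 * (K * m₁) ^ 2
          * Real.exp (-((h : ℝ) ^ p * m₁ ^ 2 / (2 * (b - a) ^ 2))) := by
  have hcond (S : Finset (Fin h)) (hS : P S ≠ 0) :=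
    integrable_and_norm_integral_aeGrad_le hV hη hc hS hm hkη hb hK hτ i
  have hint (S : Finset (Fin h)) (hS : P S ≠ 0) := (hcond S hS).1
  refine ⟨integrable_codeLaw hint,
    (norm_integral_codeLaw_le hint fun S hS => (hcond S hS).2).trans ?_⟩
  simp only [mul_add, Finset.sum_add_distrib, ← Finset.sum_mul, sum_toReal_pmf_eq_one, one_mul,
    mul_ite, mul_zero, ← Finset.sum_filter]
  gcongr
  exact hc.sum_toReal_mem_le_rpow i

end ExpectedGradient

section Asymptotics

theorem isLittleO_natCast_rpow_rpow {r s : ℝ} (hrs : r < s) :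
    (fun h : ℕ => (h : ℝ) ^ r) =o[atTop] fun h : ℕ => (h : ℝ) ^ s := by
  have hzero : Tendsto (fun h : ℕ => (h : ℝ) ^ (-(s - r))) atTop (nhds 0) :=
    (tendsto_rpow_neg_atTop (sub_pos.mpr hrs)).comp tendsto_natCast_atTop_atTop
  refine ((isLittleO_one_iff ℝ).mpr hzero).mul_isBigO (isBigO_refl (fun h : ℕ => (h : ℝ) ^ s) _)
    |>.congr' ?_ (Eventually.of_forall fun _ => one_mul _)
  filter_upwards [eventually_gt_atTop 0] with h hh
  rw [← Real.rpow_add (by exact_mod_cast hh)]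
  ring_nf

theorem Superpolynomial.rpow_isLittleO {f : ℕ → ℝ} (hf : Superpolynomial f) (s : ℝ) :
    (fun h : ℕ => (h : ℝ) ^ s) =o[atTop] f := by
  refine IsBigO.trans_isLittleO (IsBigO.of_bound' ?_) (hf ⌈s⌉₊)
  filter_upwards [eventually_ge_atTop 1] with h hh
  have hh1 : (1 : ℝ) ≤ h := by exact_mod_cast hh
  rw [Real.norm_of_nonneg (by positivity), Real.norm_of_nonneg (by positivity),
    ← Real.rpow_natCast]
  exact Real.rpow_le_rpow_of_exponent_le hh1 (Nat.le_ceil s)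

theorem eventually_pos_of_superpolynomial_exp {E : ℕ → ℝ}
    (hE : Superpolynomial fun h => Real.exp (E h)) : ∀ᶠ h in atTop, 0 < E h := by
  filter_upwards [(hE 1).bound one_pos, eventually_gt_atTop 1] with h hbound hh
  have hh1 : (1 : ℝ) < h := by exact_mod_cast hh
  rw [pow_one, one_mul, Real.norm_natCast, Real.norm_of_nonneg (Real.exp_nonneg _)] at hbound
  exact Real.one_lt_exp_iff.mp (hh1.trans_le hbound)

theorem tendsto_sq_rpow_mul_zero {p : ℝ} {η : ℕ → ℝ}
    (hη : η =o[atTop] fun h : ℕ => (h : ℝ) ^ (-(2 * p))) :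
    Tendsto (fun h : ℕ => ((h : ℝ) ^ p) ^ 2 * η h) atTop (nhds 0) := by
  refine hη.tendsto_div_nhds_zero.congr fun h => ?_
  rw [Real.rpow_neg h.cast_nonneg, mul_comm 2, Real.rpow_mul h.cast_nonneg, Real.rpow_two,
    div_inv_eq_mul, mul_comm]

theorem exists_eventually_le_mul_rpow_mul {a b : ℕ → ℝ} {c : ℝ} (ha : ∀ h, 0 ≤ a h)
    (hab : (fun h : ℕ => b h * (h : ℝ) ^ (-c)) =O[atTop] a) :
    ∃ C ≥ 0, ∀ᶠ h : ℕ in atTop, b h ≤ C * (h : ℝ) ^ c * a h := by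
  obtain ⟨C, hC, hbound⟩ := hab.exists_nonneg
  refine ⟨C, hC, ?_⟩
  filter_upwards [hbound.bound, eventually_gt_atTop 0] with h hle hh
  have hpow : (0 : ℝ) < (h : ℝ) ^ c := Real.rpow_pos_of_pos (by exact_mod_cast hh) c
  rw [Real.norm_of_nonneg (ha h)] at hle
  have hle' := (le_abs_self _).trans hle
  rw [Real.rpow_neg h.cast_nonneg, ← div_eq_mul_inv, div_le_iff₀ hpow] at hle'
  exact hle'.trans_eq (mul_right_comm _ _ _)

theorem isBigO_div_max_div {α : Type*} {l : Filter α} {u w : α → ℝ} (hu : ∀ x, 0 ≤ u x)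
    (hw : ∀ x, 0 ≤ w x) (v : α → ℝ) :
    (fun x => u x / w x) =O[l] fun x => max (u x) (v x) / w x := by
  refine IsBigO.of_bound' (Eventually.of_forall fun x => ?_)
  have hle : u x / w x ≤ max (u x) (v x) / w x :=
    div_le_div_of_nonneg_right (le_max_left _ _) (hw x)
  have hnonneg : 0 ≤ u x / w x := div_nonneg (hu x) (hw x)
  rwa [Real.norm_of_nonneg hnonneg, Real.norm_of_nonneg (hnonneg.trans hle)]

theorem gradient_bound_eq_mul_sq_div_rpow {t : ℝ} (ht : 0 < t) (p c C m ρ E : ℝ) :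
    t ^ (p - 1) * (54 * ρ * m ^ 2) + 25 * t ^ 3 * (C * t ^ c * m) ^ 2 * Real.exp (-E)
      = (54 * ρ + 25 * C ^ 2 * (t ^ (4 + 2 * c - p) / Real.exp E)) * (m ^ 2 / t ^ (1 - p)) := by
  have hpow : t ^ 3 * (t ^ c) ^ 2 = t ^ (4 + 2 * c - p) * t ^ (p - 1) := by
    rw [← Real.rpow_natCast t 3, ← Real.rpow_mul_natCast ht.le, ← Real.rpow_add ht,
      ← Real.rpow_add ht]
    push_cast
    ring_nf
  have hinv : m ^ 2 / t ^ (1 - p) = t ^ (p - 1) * m ^ 2 := by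
    rw [← neg_sub, Real.rpow_neg ht.le, div_inv_eq_mul, mul_comm]
  rw [hinv, Real.exp_neg]
  linear_combination 25 * C ^ 2 * m ^ 2 * (Real.exp E)⁻¹ * hpow

end Asymptotics

theorem theorem3p2_general
    (p c ξ : ℝ) (hξ : 2 * p < ξ)
    (n : ℕ → ℕ) (A : (h : ℕ) → Fin h → EuclideanSpace ℝ (Fin (n h)))
    (hA : ∀ h, IsIncoherentDictionary (A h) ξ)
    (a b m₁ m₂ : ℕ → ℝ)
    (P : (h : ℕ) → PMF (Finset (Fin h)))
    (D : (h : ℕ) → Finset (Fin h) → Measure (Fin h → ℝ))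
    (hcode : ∀ h, IsSparseCode (P h) (D h) p (a h) (b h) (m₁ h) (m₂ h))
    (hab : (fun h : ℕ => b h * (h : ℝ) ^ (-c)) =O[atTop] a)
    (δ : ℕ → ℝ) (hδ : δ =o[atTop] fun h : ℕ => (h : ℝ) ^ (-(2 * p)))
    (hsuper : Superpolynomial fun h =>
      Real.exp ((h : ℝ) ^ p * m₁ h ^ 2 / (2 * (b h - a h) ^ 2))) :
    ∃ g : ℕ → ℝ,
      g =o[atTop] (fun h : ℕ => m₁ h ^ 2 / (h : ℝ) ^ (1 - p)) ∧
      ∀ᶠ h : ℕ in atTop, ∀ W : Fin h → EuclideanSpace ℝ (Fin (n h)),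
        (∀ i, ‖W i - A h i‖ ≤ δ h) → ∀ τ : ℝ, |τ| ≤ 1 → ∀ i : Fin h,
          Integrable
            (fun x => aeGrad τ W (aeBias h p ξ (m₁ h) (δ h)) (signal (A h) x) i)
            (codeLaw (P h) (D h)) ∧
          ‖∫ x, aeGrad τ W (aeBias h p ξ (m₁ h) (δ h)) (signal (A h) x) i
            ∂(codeLaw (P h) (D h))‖ ≤ g h := by
  obtain ⟨C, hC, hbC⟩ := exists_eventually_le_mul_rpow_mul (fun h => (hcode h).a_nonneg) hab
  have hρ : Tendsto (fun h : ℕ => ((h : ℝ) ^ p) ^ 2 * (δ h + (h : ℝ) ^ (-ξ))) atTop (nhds 0) :=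
    tendsto_sq_rpow_mul_zero (hδ.add (isLittleO_natCast_rpow_rpow (neg_lt_neg hξ)))
  have htail := (hsuper.rpow_isLittleO (4 + 2 * c - p)).tendsto_div_nhds_zero
  have hfactor := (hρ.const_mul 54).add (htail.const_mul (25 * C ^ 2))
  rw [mul_zero, mul_zero, add_zero] at hfactor
  refine ⟨_, (((isLittleO_one_iff ℝ).mpr hfactor).mul_isBigO (isBigO_refl _ _)).congr_right
    fun _ => one_mul _, ?_⟩
  filter_upwards [hbC, hρ.eventually_le_const one_half_pos,
    eventually_pos_of_superpolynomial_exp hsuper] with h hb hρh hE W hW τ hτ i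
  have hh : (0 : ℝ) < h := by exact_mod_cast i.pos
  have hm : 0 < m₁ h := (hcode h).mean_nonneg.lt_of_ne' fun hzero => by simp [hzero] at hE
  have hη : 0 < δ h + (h : ℝ) ^ (-ξ) :=
    add_pos_of_nonneg_of_pos ((norm_nonneg _).trans (hW i)) (by positivity)
  rw [← gradient_bound_eq_mul_sq_div_rpow hh]
  exact integrable_and_norm_integral_aeGrad_codeLaw_le ((hA h).isPerturbedDictionary hW) hη
    (hcode h) hm (by linarith) hb (by positivity) hτ i

theorem theorem3p2
    (p ν ξ : ℝ) (hp0 : 0 < p) (hp1 : p < min (1 / 2) (ν ^ 2)) (hν : 0 < ν)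
    (hξ : p + ν ^ 2 < ξ)
    (n : ℕ → ℕ) (A : (h : ℕ) → Fin h → EuclideanSpace ℝ (Fin (n h)))
    (hA : ∀ h, IsIncoherentDictionary (A h) ξ)
    (a b m₁ m₂ : ℕ → ℝ)
    (P : (h : ℕ) → PMF (Finset (Fin h)))
    (D : (h : ℕ) → Finset (Fin h) → Measure (Fin h → ℝ))
    (hcode : ∀ h, IsSparseCode (P h) (D h) p (a h) (b h) (m₁ h) (m₂ h))
    (hab : (fun h : ℕ => b h * (h : ℝ) ^ (-ν ^ 2)) =O[atTop] a)
    (δ : ℕ → ℝ) (hδ : δ =O[atTop] fun h : ℕ => (h : ℝ) ^ (-p - ν ^ 2))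
    (hsuper : Superpolynomial fun h =>
      Real.exp ((h : ℝ) ^ p * m₁ h ^ 2 / (2 * (b h - a h) ^ 2))) :
    ∃ g : ℕ → ℝ,
      g =o[atTop] (fun h : ℕ => max (m₁ h ^ 2) (m₂ h) / (h : ℝ) ^ (1 - p)) ∧
      ∀ᶠ h : ℕ in atTop, ∀ W : Fin h → EuclideanSpace ℝ (Fin (n h)),
        (∀ i, ‖W i - A h i‖ ≤ δ h) → ∀ τ ∈ Set.Icc (0 : ℝ) 1, ∀ i : Fin h,
          Integrable
            (fun x => aeGrad τ W (aeBias h p ξ (m₁ h) (δ h)) (signal (A h) x) i)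
            (codeLaw (P h) (D h)) ∧
          ‖∫ x, aeGrad τ W (aeBias h p ξ (m₁ h) (δ h)) (signal (A h) x) i
            ∂(codeLaw (P h) (D h))‖ ≤ g h := by
  have hpν : p < ν ^ 2 := hp1.trans_le (min_le_right _ _)
  obtain ⟨g, hg, hbound⟩ := theorem3p2_general p (ν ^ 2) ξ (by linarith) n A hA a b m₁ m₂ P D hcode
    hab δ (hδ.trans_isLittleO (isLittleO_natCast_rpow_rpow (by linarith))) hsuper
  exact ⟨g, hg.trans_isBigO (isBigO_div_max_div (fun h => sq_nonneg (m₁ h))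
    (fun h => Real.rpow_nonneg h.cast_nonneg _) m₂), hbound.mono fun h hh W hW τ hτ =>
      hh W hW τ (abs_le.mpr ⟨neg_one_lt_zero.le.trans hτ.1, hτ.2⟩)⟩
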